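/- Let $1\le k\le n$, and let $A$ be the Laplacian of the complete directed graph on the nodes $\{0,1,\dots,n\}$ with indeterminate edge weights $a_{ij}$: $A_{ij}=-a_{ij}$ for $i\ne j$ and $A_{ii}=\sum_{l\neq i}a_{il}$. For $i,j\in\{1,\dots,k\}$ put $D_{ij}=\det A[\{i,k+1,\dots,n\},\{j,k+1,\dots,n\}]$ (rows in the first set, columns in the second set), and consider the right-hand side of the Dodgson/Muir identity for $A$ with its zeroth row and column removed, $$\sum_{\sigma\in S_k}T_\sigma,\qquad T_\sigma=\operatorname{sgn}(\sigma)\prod_{i=1}^k D_{i\sigma(i)} .$$ A directed rooted forest on $\{0,\dots,n\}$ is a directed graph in which every node has at most one out-edge and every node is connected by a directed path to a node without out-edge (a root); its weight $a_G$ is the product of the weights $a_{vw}$ of its edges $v\to w$. A meta-edge $v\to w$ is a directed path from $v$ to $w$, possibly of length zero. Let $\mathcal F$ be the set of ordered $k$-tuples $F=(F_1,\dots,F_k)$ in which $F_i$ is a forest whose set of roots is exactly $\{0,1,\dots,k\}\setminus\{i\}$. A meta-cycle of $F$ is a cyclic sequence, considered up to rotation, of at least two distinct nodes of $\{1,\dots,k\}$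 such that whenever $b$ directly follows $a$ in it, the forest $F_a$ has a meta-edge $a\to b$. For $\sigma\in S_k$ and $F\in\mathcal F$ let $$c(\sigma,F)=\operatorname{sgn}(\sigma)\prod_{i=1}^k\big[a_{F_i}\big]D_{i\sigma(i)},$$ where $[a_{G}]D$ is the coefficient of the monomial $a_{G}$ in $D$. We say that $F$ arises from $\sigma$ if $c(\sigma,F)\ne0$. Then: 1. For all $i,j\in\{1,\dots,k\}$, $D_{ij}=\sum_G \big([a_G]D_{ij}\big)\,a_G$, where $G$ runs over the forests whose set of roots is exactly $\{0,\dots,k\}\setminus\{i\}$. For every $\sigma\in S_k$, $T_\sigma=\sum_{F\in\mathcal F}c(\sigma,F)\prod_{i=1}^k a_{F_i}$. 2. $F\in\mathcal F$ arises from $\sigma$ if and only if $F_i$ has a meta-edge $i\to\sigma(i)$ for every $i$. In that case $c(\sigma,F)=(-1)^{r}$, where $r$ is the number of cycles of $\sigma$ of length at least $2$. 3. If $F\in\mathcal F$ has exactly $m\ge1$ meta-cycles, then $F$ arises from exactly $2^m$ permutations $\sigma\in S_k$, of which $2^{m-1}$ have $c(\sigma,F)=1$ and $2^{m-1}$ have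 $c(\sigma,F)=-1$. Hence $\sum_{\sigma}c(\sigma,F)=0$. 4. If $F\in\mathcal F$ has no meta-cycle, then $c(\mathrm{id},F)=1$ and $c(\sigma,F)=0$ for all $\sigma\ne\mathrm{id}$. 5. Consequently $\sum_{\sigma\in S_k}T_\sigma=\sum_{F}\prod_{i=1}^k a_{F_i}$, where $F$ runs over the tuples in $\mathcal F$ that have no meta-cycle. -/

import Mathlib

namespace ForestDodgson

/-! ### Directed graphs with at most one out-edge per node, and rooted forests -/

/-- A directed graph on the nodes `0, …, n` in which each node has at most one out-edge:
`G v = some w` if there is an edge `v → w`, and `G v = none` if `v` has no out-edge. -/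
abbrev OutGraph (n : ℕ) : Type := Fin (n + 1) → Option (Fin (n + 1))

/-- There is a directed path (possibly of length zero) from `v` to `w` in `G`,
that is, a meta-edge `v → w`. -/
def MetaEdge {n : ℕ} (G : OutGraph n) (v w : Fin (n + 1)) : Prop :=
  Relation.ReflTransGen (fun x y => G x = some y) v w

/-- `G` is a directed rooted forest whose set of roots is exactly `U`: the nodes without out-edge
are those of `U`, and every node is connected to some root by a directed path. -/
def IsForestRootedAt {n : ℕ} (U : Finset (Fin (n + 1))) (G : OutGraph n) : Prop :=
  (∀ v, G v = none ↔ v ∈ U) ∧ ∀ v, ∃ r ∈ U, MetaEdge G v r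

open Classical in
/-- The set `R_U` of forests with roots at exactly the nodes in `U`. -/
noncomputable def forests {n : ℕ} (U : Finset (Fin (n + 1))) : Finset (OutGraph n) :=
  Finset.univ.filter (IsForestRootedAt U)

/-- The product of the weights of the edges of `G`, where `a v w` is the weight of `v → w`. -/
def graphWeight {n : ℕ} {R : Type*} [CommRing R] (a : Fin (n + 1) → Fin (n + 1) → R)
    (G : OutGraph n) : R :=
  ∏ v, (G v).elim 1 (a v)

/-! ### The Laplacian and its minors -/

/-- The Laplacian of the complete directed graph on `0, …, n` with edge weights `a`. -/
def laplacian {n : ℕ} {R : Type*} [CommRing R] (a : Fin (n + 1) → Fin (n + 1) → R) :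
    Matrix (Fin (n + 1)) (Fin (n + 1)) R :=
  Matrix.of fun i j => if i = j then ∑ l ∈ Finset.univ.erase i, a i l else - a i j

/-- `det (M[U, W])`: the determinant of the matrix formed by the rows of `M` in `U` and the
columns of `M` in `W`, both in increasing order. -/
def minorDet {N : ℕ} {R : Type*} [CommRing R] (M : Matrix (Fin N) (Fin N) R)
    (U W : Finset (Fin N)) (h : W.card = U.card) : R :=
  (M.submatrix (U.orderEmbOfFin rfl) (W.orderEmbOfFin h)).det

/-- The formal weight `a_{ij}` of the edge `i → j`: an indeterminate. -/
noncomputable def edgeVar {n : ℕ} (i j : Fin (n + 1)) :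
    MvPolynomial (Fin (n + 1) × Fin (n + 1)) ℤ :=
  MvPolynomial.X (i, j)

/-- The exponent vector of the monomial `graphWeight edgeVar G`. -/
noncomputable def edgeExponent {n : ℕ} (G : OutGraph n) :
    (Fin (n + 1) × Fin (n + 1)) →₀ ℕ :=
  ∑ v, (G v).elim 0 fun w => Finsupp.single (v, w) 1

theorem graphWeight_edgeVar {n : ℕ} (G : OutGraph n) :
    graphWeight edgeVar G = MvPolynomial.monomial (edgeExponent G) (1 : ℤ) := by
  unfold graphWeight edgeExponent
  rw [MvPolynomial.monomial_sum_one]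
  refine Finset.prod_congr rfl fun v _ => ?_
  cases G v <;> rfl

/-! ### The right-hand side of the Dodgson/Muir identity for the Laplacian

The elements `0, …, k - 1` of `Fin k` stand for the nodes `1, …, k`. -/

/-- The node `i + 1`, for `i : Fin k`; these are the nodes `1, …, k`. -/
def node {n k : ℕ} (hkn : k ≤ n) (i : Fin k) : Fin (n + 1) :=
  ⟨i.val + 1, by have := i.isLt; omega⟩

/-- The set of nodes `{0, 1, …, k}`. -/
def special (n k : ℕ) : Finset (Fin (n + 1)) :=
  Finset.univ.filter fun v => v.val ≤ k

/-- The index set `{i, k+1, …, n}`, for `i ∈ {1, …, k}`. -/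
def minorIndices {n k : ℕ} (hkn : k ≤ n) (i : Fin k) : Finset (Fin (n + 1)) :=
  insert (node hkn i) (Finset.univ.filter fun v => k < v.val)

theorem card_minorIndices {n k : ℕ} (hkn : k ≤ n) (i j : Fin k) :
    (minorIndices hkn j).card = (minorIndices hkn i).card := by
  have h (l : Fin k) :
      node hkn l ∉ (Finset.univ.filter fun v : Fin (n + 1) => k < v.val) := by
    simp [node]
  unfold minorIndices
  rw [Finset.card_insert_of_notMem (h i), Finset.card_insert_of_notMem (h j)]

/-- `det (A[{i, k+1, …, n}, {j, k+1, …, n}])`, with `A` the Laplacian with indeterminate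
weights. -/
noncomputable def laplacianMinor {n k : ℕ} (hkn : k ≤ n) (i j : Fin k) :
    MvPolynomial (Fin (n + 1) × Fin (n + 1)) ℤ :=
  minorDet (laplacian edgeVar) (minorIndices hkn i) (minorIndices hkn j)
    (card_minorIndices hkn i j)

/-- The term indexed by `σ` of the right-hand side of the Dodgson/Muir identity. -/
noncomputable def muirTerm {n k : ℕ} (hkn : k ≤ n) (σ : Equiv.Perm (Fin k)) :
    MvPolynomial (Fin (n + 1) × Fin (n + 1)) ℤ :=
  ((Equiv.Perm.sign σ : ℤ) : MvPolynomial (Fin (n + 1) × Fin (n + 1)) ℤ) *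
    ∏ i, laplacianMinor hkn i (σ i)

/-! ### Tuples of forests, meta-cycles, and contributions -/

/-- The ordered `k`-tuples of forests whose `i`-th member has its roots at exactly
`0, …, i-1, i+1, …, k`. -/
noncomputable def forestTuples {n k : ℕ} (hkn : k ≤ n) : Finset (Fin k → OutGraph n) :=
  Fintype.piFinset fun i => forests (special n k \ {node hkn i})

/-- The product of the weights of the forests of a tuple, with indeterminate edge weights. -/
noncomputable def tupleWeight {n k : ℕ} (F : Fin k → OutGraph n) :
    MvPolynomial (Fin (n + 1) × Fin (n + 1)) ℤ :=
  ∏ i, graphWeight edgeVar (F i)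

/-- The tuple `F` belongs to `R^σ`: its `i`-th member is a forest with roots at
`0, …, i-1, i+1, …, k` that has a meta-edge `i → σ(i)`, for every `i`. -/
def MemR {n k : ℕ} (hkn : k ≤ n) (σ : Equiv.Perm (Fin k)) (F : Fin k → OutGraph n) : Prop :=
  F ∈ forestTuples hkn ∧ ∀ i, MetaEdge (F i) (node hkn i) (node hkn (σ i))

/-- A meta-cycle of `F`: a cyclic sequence `i → a₁ → ⋯ → aₘ → i` of at least two distinct nodes
of `{1, …, k}` such that whenever `b` directly follows `a` in it, the `a`-th forest has a
meta-edge `a → b`. Cyclic rotations of a sequence are identified. -/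
def IsMetaCycle {n k : ℕ} (hkn : k ≤ n) (F : Fin k → OutGraph n) (c : Cycle (Fin k)) : Prop :=
  c.Nodup ∧ c.Nontrivial ∧ c.Chain fun a b => MetaEdge (F a) (node hkn a) (node hkn b)

/-- The number of meta-cycles of `F`. -/
noncomputable def numMetaCycles {n k : ℕ} (hkn : k ≤ n) (F : Fin k → OutGraph n) : ℕ :=
  Set.ncard {c : Cycle (Fin k) | IsMetaCycle hkn F c}

open Classical in
/-- The tuples of forests that have no meta-cycle. -/
noncomputable def nonForbiddenTuples {n k : ℕ} (hkn : k ≤ n) : Finset (Fin k → OutGraph n) :=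
  (forestTuples hkn).filter fun F => ¬ ∃ c, IsMetaCycle hkn F c

/-- The signed multiplicity with which the tuple `F` occurs in the term indexed by `σ`, when the
determinants of that term are expanded separately, the `i`-th one supplying the `i`-th forest:
the sign of `σ` times the coefficients of the monomials of the `F i` in the determinants. -/
noncomputable def contribution {n k : ℕ} (hkn : k ≤ n) (σ : Equiv.Perm (Fin k))
    (F : Fin k → OutGraph n) : ℤ :=
  (Equiv.Perm.sign σ : ℤ) *
    ∏ i, MvPolynomial.coeff (edgeExponent (F i)) (laplacianMinor hkn i (σ i))

end ForestDodgson

open ForestDodgson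

namespace ForestDodgson

open Matrix

/-! Row `r` of the Laplacian is `∑ w, a r w • (e_r - e_w)`. Multilinearity in the rows therefore
turns a minor with row set `S` into a sum over all choices of one out-edge per node of `S`, each
weighted by the determinant of a matrix with entries in {0, 1, -1}. For equal row and column sets
this determinant is 1 on forests and 0 otherwise (`det_stepMatrix`). If column `i` is exchanged for
a column `j` outside `S`, Cramer's rule gives -1 on forests with a path from `i` to `j`, and 0
otherwise (`det_stepMatrix_updateCol`). Distinct graphs have distinct monomials, so these numbers
are the coefficients in the minors.

For a fixed tuple `F`, the permutations with nonzero contribution are thus those moving each `a`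
along a meta-edge of `F a`. Every special node other than `a` is a root of `F a`, so `a` has at most
one proper successor among 1, …, k. Hence the meta-cycles are pairwise disjoint, and these
permutations correspond to sets of meta-cycles (`image_cycleFactorsFinset`). The sign of the
permutation and one -1 per moved point combine to one -1 per cycle (`sign_mul_prod_ite`). The
contributions of `F` sum to the alternating sum over subsets of its meta-cycles, which is 0 unless
there are none. -/

theorem metaEdge_iff {n : ℕ} {G : OutGraph n} {v w : Fin (n + 1)} :
    MetaEdge G v w ↔ v = w ∨ ∃ u, G v = some u ∧ MetaEdge G u w := by
  unfold MetaEdge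
  rw [Relation.ReflTransGen.cases_head_iff]

theorem MetaEdge.eq_of_none {n : ℕ} {G : OutGraph n} {v w : Fin (n + 1)} (h : MetaEdge G v w)
    (hv : G v = none) : v = w := by
  rcases metaEdge_iff.1 h with h | ⟨u, hu, -⟩
  · exact h
  · simp [hv] at hu

/-! ### Determinants attached to a choice of out-edges -/

/-- The graph whose edges are `v → g v` for `v ∈ S`. -/
def ofFun {n : ℕ} (S : Finset (Fin (n + 1))) (g : S → Fin (n + 1)) : OutGraph n :=
  fun v => if h : v ∈ S then some (g ⟨v, h⟩) else none

section ofFun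

variable {n : ℕ} {S : Finset (Fin (n + 1))} (g : S → Fin (n + 1))

theorem ofFun_coe (r : S) : ofFun S g r = some (g r) := by simp [ofFun]

theorem ofFun_of_notMem {v : Fin (n + 1)} (h : v ∉ S) : ofFun S g v = none := by simp [ofFun, h]

theorem ofFun_eq_none_iff {v : Fin (n + 1)} : ofFun S g v = none ↔ v ∉ S := by
  by_cases h : v ∈ S <;> simp [ofFun, h]

theorem metaEdge_ofFun_coe {r : S} {w : Fin (n + 1)} (h : (r : Fin (n + 1)) ≠ w) :
    MetaEdge (ofFun S g) r w ↔ MetaEdge (ofFun S g) (g r) w := by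
  rw [metaEdge_iff]
  simp [h, ofFun_coe]

theorem metaEdge_ofFun_of_notMem {v w : Fin (n + 1)} (h : v ∉ S) :
    MetaEdge (ofFun S g) v w ↔ v = w :=
  ⟨fun h' => h'.eq_of_none (ofFun_of_notMem g h), fun h' => h' ▸ Relation.ReflTransGen.refl⟩

theorem isForestRootedAt_ofFun_iff :
    IsForestRootedAt Sᶜ (ofFun S g) ↔ ∀ v, ∃ r ∉ S, MetaEdge (ofFun S g) v r := by
  simp [IsForestRootedAt, ofFun_eq_none_iff]

theorem graphWeight_ofFun {R : Type*} [CommRing R] (a : Fin (n + 1) → Fin (n + 1) → R) :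
    graphWeight a (ofFun S g) = ∏ r : S, a r (g r) := by
  unfold graphWeight
  rw [← Finset.prod_subset (Finset.subset_univ S), ← Finset.prod_coe_sort]
  · simp [ofFun_coe]
  · intro v _ hv
    simp [ofFun_of_notMem g hv]

/-- The identity minus the adjacency matrix of the graph `ofFun S g`, restricted to `S`. -/
def stepMatrix (R : Type*) [CommRing R] : Matrix S S R :=
  of fun r c => (if r = c then 1 else 0) - if g r = c then 1 else 0

theorem stepMatrix_mulVec {R : Type*} [CommRing R] (y : Fin (n + 1) → R) (r : S) :
    (stepMatrix g R *ᵥ fun c => y c) r = y r - if g r ∈ S then y (g r) else 0 := by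
  have h : ∑ c : S, (if g r = c then y c else 0) = if g r ∈ S then y (g r) else 0 := by
    rw [Finset.sum_coe_sort S fun c => if g r = c then y c else 0]
    simp
  simp only [stepMatrix, mulVec, dotProduct, of_apply, sub_mul, Finset.sum_sub_distrib, ite_mul,
    one_mul, zero_mul, h, Finset.sum_ite_eq, Finset.mem_univ, if_true]

-- In a forest the edges strictly decrease a rank, so the matrix is block triangular with identity
-- blocks. Otherwise the indicator of the nodes that never leave `S` is a kernel vector with an
-- entry 1; multiplying by the adjugate kills the determinant over any commutative ring.
open Classical in
theorem det_stepMatrix (R : Type*) [CommRing R] :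
    (stepMatrix g R).det = if IsForestRootedAt Sᶜ (ofFun S g) then 1 else 0 := by
  rw [isForestRootedAt_ofFun_iff]
  split_ifs with hG
  -- Out-edges are unique, so accessibility propagates backwards along the path from `v` to a node
  -- outside `S`.
  · have hwf : WellFounded fun x y => ofFun S g y = some x := by
      refine ⟨fun v => ?_⟩
      obtain ⟨r, hr, hvr⟩ := hG v
      induction hvr using Relation.ReflTransGen.head_induction_on with
      | refl => exact ⟨_, fun y hy => by simp [ofFun_of_notMem g hr] at hy⟩
      | head hab _ ih =>
        refine ⟨_, fun y hy => ?_⟩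
        rw [hab] at hy
        exact Option.some.inj hy ▸ ih
    have hwf' : IsWellFounded _ fun x y => ofFun S g y = some x := ⟨hwf⟩
    let rank := IsWellFounded.rank fun x y => ofFun S g y = some x
    have hrank (r : S) : rank (g r) < rank (r : Fin (n + 1)) :=
      IsWellFounded.rank_lt_of_rel (r := fun x y => ofFun S g y = some x) (ofFun_coe g r)
    have htri : (stepMatrix g R).BlockTriangular
        fun r => OrderDual.toDual (rank (r : Fin (n + 1))) := by
      intro r c hrc
      have hrc' : rank (r : Fin (n + 1)) < rank (c : Fin (n + 1)) := hrc
      have h1 : r ≠ c := by rintro rfl; exact lt_irrefl _ hrc'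
      have h2 : g r ≠ c := by
        intro h
        exact lt_asymm hrc' (h ▸ hrank r)
      simp [stepMatrix, h1, h2]
    rw [htri.det]
    refine Finset.prod_eq_one fun d _ => ?_
    have hone : (stepMatrix g R).toSquareBlock
        (fun r => OrderDual.toDual (rank (r : Fin (n + 1)))) d = 1 := by
      ext ⟨r, hr⟩ ⟨c, hc⟩
      have h2 : g r ≠ c := by
        intro h
        have h3 := hrank r
        rw [h] at h3
        exact h3.ne (OrderDual.toDual.injective (hc.trans hr.symm))
      simp [toSquareBlock_def, stepMatrix, h2, Matrix.one_apply]
    rw [hone, det_one]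
  · push Not at hG
    obtain ⟨v, hv⟩ := hG
    have hvS : v ∈ S := by
      by_contra h
      exact hv v h Relation.ReflTransGen.refl
    let y : Fin (n + 1) → R := fun v => if ∃ r ∉ S, MetaEdge (ofFun S g) v r then 0 else 1
    have hy : (stepMatrix g R *ᵥ fun c => y c) = 0 := by
      ext r
      rw [stepMatrix_mulVec]
      have h1 : y r = y (g r) := by
        have : (∃ w ∉ S, MetaEdge (ofFun S g) r w) ↔ ∃ w ∉ S, MetaEdge (ofFun S g) (g r) w := by
          refine exists_congr fun w => and_congr_right fun hw => metaEdge_ofFun_coe g ?_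
          rintro rfl
          exact hw r.2
        simp only [y, this]
      have h2 : g r ∉ S → y (g r) = 0 := fun h => if_pos ⟨_, h, Relation.ReflTransGen.refl⟩
      split_ifs with h
      · simp [h1]
      · simp [h1, h2 h]
    have h := congrFun (congrArg ((stepMatrix g R).adjugate *ᵥ ·) hy) ⟨v, hvS⟩
    have hv' : ¬ ∃ r ∉ S, MetaEdge (ofFun S g) v r := by
      push Not
      exact hv
    simpa [mulVec_mulVec, adjugate_mul, smul_mulVec, y, hv'] using h

-- The new column is the step matrix applied to `y`, minus the indicator of reaching `j`. By
-- Cramer's rule the determinant is `y i` times that of the step matrix.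
open Classical in
theorem det_stepMatrix_updateCol (R : Type*) [CommRing R] (i : S) {j : Fin (n + 1)} (hj : j ∉ S) :
    ((stepMatrix g R).updateCol i fun r => -if g r = j then 1 else 0).det =
      if IsForestRootedAt Sᶜ (ofFun S g) ∧ MetaEdge (ofFun S g) i j then -1 else 0 := by
  let y : Fin (n + 1) → R := fun v => if MetaEdge (ofFun S g) v j then -1 else 0
  have hy : (fun r => -if g r = j then (1 : R) else 0) = stepMatrix g R *ᵥ fun c => y c := by
    ext r
    rw [stepMatrix_mulVec]
    have hrj : (r : Fin (n + 1)) ≠ j := by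
      rintro rfl
      exact hj r.2
    have h1 : y r = y (g r) := by simp only [y, metaEdge_ofFun_coe g hrj]
    by_cases h : g r ∈ S
    · have : g r ≠ j := by
        intro h'
        exact hj (h' ▸ h)
      simp [h1, h, this]
    · have : y (g r) = if g r = j then -1 else 0 := by
        simp only [y, metaEdge_ofFun_of_notMem g h]
      simp only [h1, h, this, if_false, sub_zero]
      split_ifs <;> simp
  rw [hy, ← cramer_apply, cramer_eq_adjugate_mulVec, mulVec_mulVec, adjugate_mul, det_stepMatrix]
  by_cases h1 : IsForestRootedAt Sᶜ (ofFun S g) <;>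
    by_cases h2 : MetaEdge (ofFun S g) i j <;> simp [h1, h2, y]

end ofFun

/-! ### Expansion of Laplacian minors over forests -/

open Classical in
theorem forests_eq_filter_image {n : ℕ} (S : Finset (Fin (n + 1))) :
    forests Sᶜ = (Finset.univ.image (ofFun S)).filter (IsForestRootedAt Sᶜ) := by
  ext G
  simp only [forests, Finset.mem_filter, Finset.mem_univ, true_and, Finset.mem_image,
    iff_and_self]
  intro hG
  have hS (r : S) : (G r).isSome := by
    rw [Option.isSome_iff_ne_none, Ne, hG.1]
    simp
  refine ⟨fun r => (G r).get (hS r), funext fun v => ?_⟩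
  by_cases hv : v ∈ S
  · simp [ofFun, hv]
  · simp [ofFun, hv, (hG.1 v).2 (by simpa using hv)]

theorem ofFun_injective {n : ℕ} (S : Finset (Fin (n + 1))) : Function.Injective (ofFun S) := by
  intro g g' h
  ext1 r
  have := congrFun h r
  simpa [ofFun_coe] using this

open Classical in
theorem sum_ofFun_ite {n : ℕ} (S : Finset (Fin (n + 1))) {M : Type*} [AddCommMonoid M]
    (p : OutGraph n → Prop) (f : OutGraph n → M) :
    ∑ g : S → Fin (n + 1), (if IsForestRootedAt Sᶜ (ofFun S g) ∧ p (ofFun S g)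
      then f (ofFun S g) else 0) = ∑ G ∈ forests Sᶜ, if p G then f G else 0 := by
  rw [forests_eq_filter_image, Finset.sum_filter, Finset.sum_image (ofFun_injective S).injOn]
  refine Finset.sum_congr rfl fun g _ => ?_
  rw [ite_and]

/-- The term `w = r` vanishes, so the sum may run over all `w` although the Laplacian has no loop
weights. -/
theorem laplacian_apply_eq_sum {n : ℕ} {R : Type*} [CommRing R]
    (a : Fin (n + 1) → Fin (n + 1) → R) (r c : Fin (n + 1)) :
    laplacian a r c = ∑ w, a r w * ((if r = c then 1 else 0) - if w = c then 1 else 0) := by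
  simp only [mul_sub, Finset.sum_sub_distrib, mul_ite, mul_one, mul_zero, Finset.sum_ite_eq',
    Finset.mem_univ, if_true, laplacian, of_apply]
  split_ifs with h
  · subst h
    rw [← Finset.add_sum_erase _ _ (Finset.mem_univ r)]
    ring
  · simp

theorem det_laplacian_expand {n : ℕ} {R : Type*} [CommRing R]
    (a : Fin (n + 1) → Fin (n + 1) → R) (S : Finset (Fin (n + 1))) (φ : S → Fin (n + 1)) :
    (of fun r c : S => laplacian a r (φ c)).det =
      ∑ g : S → Fin (n + 1), graphWeight a (ofFun S g) *
        (of fun r c : S => (if (r : Fin (n + 1)) = φ c then 1 else 0) -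
          if g r = φ c then (1 : R) else 0).det := by
  have h : (of fun r c : S => laplacian a r (φ c)) =
      fun r : S => ∑ w, a r w • fun c : S => ((if (r : Fin (n + 1)) = φ c then 1 else 0) -
          if w = φ c then (1 : R) else 0) := by
    ext r c
    simp [laplacian_apply_eq_sum, Finset.sum_apply]
  rw [h]
  change detRowAlternating _ = _
  rw [← AlternatingMap.coe_multilinearMap, MultilinearMap.map_sum]
  refine Finset.sum_congr rfl fun g _ => ?_
  rw [MultilinearMap.map_smul_univ, graphWeight_ofFun]
  rfl

/-- Both `i` and `j` lie below all of `K`, so putting `j` in the place of `i` preserves the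
increasing order and costs no sign. -/
theorem minorDet_swap_min {n : ℕ} {R : Type*} [CommRing R]
    (M : Matrix (Fin (n + 1)) (Fin (n + 1)) R) (K : Finset (Fin (n + 1))) (i j : Fin (n + 1))
    (hi : ∀ v ∈ K, i < v) (hj : ∀ v ∈ K, j < v)
    (h : (insert j K).card = (insert i K).card) :
    minorDet M (insert i K) (insert j K) h =
      (of fun r c : (insert i K : Finset _) => M r (if (c : Fin (n + 1)) = i then j else c)).det := by
  let e := ((insert i K).orderIsoOfFin rfl)
  have hcol : (fun x => if (e x : Fin (n + 1)) = i then j else e x) =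
      (insert j K).orderEmbOfFin h := by
    refine Finset.orderEmbOfFin_unique h (fun x => ?_) fun x y hxy => ?_
    · split_ifs with hx
      · exact Finset.mem_insert_self _ _
      · exact Finset.mem_insert_of_mem ((Finset.mem_insert.1 (e x).2).resolve_left hx)
    · have hlt : (e x : Fin (n + 1)) < e y := e.strictMono hxy
      have hx := Finset.mem_insert.1 (e x).2
      have hy := Finset.mem_insert.1 (e y).2
      have hy' : (e y : Fin (n + 1)) ∈ K := by
        refine hy.resolve_left fun hy => ?_
        rcases hx with hx | hx
        · exact absurd hlt (by simp [hx, hy])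
        · exact lt_asymm (hi _ hx) (hlt.trans_eq hy)
      have hyi : (e y : Fin (n + 1)) ≠ i := (hi _ hy').ne'
      simp only [hyi, if_false]
      split_ifs with hxi
      · exact hj _ hy'
      · exact hlt
  rw [minorDet, ← hcol, ← det_submatrix_equiv_self e.toEquiv]
  rfl

section Minors

variable {n k : ℕ} (hkn : k ≤ n)

theorem node_injective : Function.Injective (node hkn) := by
  intro i j h
  have := congrArg Fin.val h
  simp only [node] at this
  exact Fin.ext (by omega)

theorem compl_minorIndices (i : Fin k) : (minorIndices hkn i)ᶜ = special n k \ {node hkn i} := by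
  ext v
  simp [minorIndices, special, and_comm]

theorem node_mem_minorIndices (i : Fin k) : node hkn i ∈ minorIndices hkn i := by
  simp [minorIndices]

theorem node_notMem_minorIndices {i j : Fin k} (h : j ≠ i) :
    node hkn j ∉ minorIndices hkn i := by
  have h1 : ¬ node hkn j = node hkn i := fun h' => h (node_injective hkn h')
  have h2 : ¬ k < (node hkn j).val := by
    simp only [node]
    omega
  simp [minorIndices, h1, h2]

open Classical in
theorem laplacianMinor_eq_sum (i j : Fin k) : laplacianMinor hkn i j =
    ∑ G ∈ forests (special n k \ {node hkn i}),
      if MetaEdge G (node hkn i) (node hkn j) then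
        (if j = i then 1 else -1) * graphWeight edgeVar G else 0 := by
  have hlt (l : Fin k) : ∀ v ∈ Finset.univ.filter fun v : Fin (n + 1) => k < v.val,
      node hkn l < v := by
    intro v hv
    simp only [Finset.mem_filter, Finset.mem_univ, true_and] at hv
    refine Fin.lt_def.2 ?_
    simp only [node]
    omega
  rw [laplacianMinor]
  simp only [minorIndices]
  rw [minorDet_swap_min _ _ _ _ (hlt i) (hlt j)]
  change (of fun r c : (minorIndices hkn i) => laplacian edgeVar r
    (if (c : Fin (n + 1)) = node hkn i then node hkn j else c)).det = _
  rw [det_laplacian_expand edgeVar (minorIndices hkn i)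
    fun c => if (c : Fin (n + 1)) = node hkn i then node hkn j else c,
    ← compl_minorIndices, ← sum_ofFun_ite]
  refine Finset.sum_congr rfl fun g _ => ?_
  by_cases hji : j = i
  · subst hji
    have hm : (of fun r c : minorIndices hkn j =>
        (if (r : Fin (n + 1)) = if (c : Fin (n + 1)) = node hkn j then node hkn j else c then 1 else 0)
          - if g r = if (c : Fin (n + 1)) = node hkn j then node hkn j else c
            then (1 : MvPolynomial (Fin (n + 1) × Fin (n + 1)) ℤ) else 0) =
        stepMatrix g _ := by
      ext1 r c
      have : (if (c : Fin (n + 1)) = node hkn j then node hkn j else (c : Fin (n + 1))) = c := by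
        split_ifs with h
        · exact h.symm
        · rfl
      simp only [of_apply, this, stepMatrix, Subtype.coe_inj]
    rw [hm, det_stepMatrix]
    have : MetaEdge (ofFun (minorIndices hkn j) g) (node hkn j) (node hkn j) :=
      Relation.ReflTransGen.refl
    simp [this]
  -- No row is indexed by node `j`, so the identity part of the exchanged column is zero.
  · have hm : (of fun r c : minorIndices hkn i =>
        (if (r : Fin (n + 1)) = if (c : Fin (n + 1)) = node hkn i then node hkn j else c then 1 else 0)
          - if g r = if (c : Fin (n + 1)) = node hkn i then node hkn j else c
            then (1 : MvPolynomial (Fin (n + 1) × Fin (n + 1)) ℤ) else 0) =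
        (stepMatrix g _).updateCol ⟨node hkn i, node_mem_minorIndices hkn i⟩
          fun r => -if g r = node hkn j then 1 else 0 := by
      ext1 r c
      have hr : (r : Fin (n + 1)) ≠ node hkn j := fun h =>
        node_notMem_minorIndices hkn hji (h ▸ r.2)
      by_cases hc : (c : Fin (n + 1)) = node hkn i
      · have hc' : c = ⟨node hkn i, node_mem_minorIndices hkn i⟩ := Subtype.ext hc
        rw [hc', updateCol_self]
        simp [hr]
      · have hc' : c ≠ ⟨node hkn i, node_mem_minorIndices hkn i⟩ := fun h =>
          hc (congrArg Subtype.val h)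
        rw [updateCol_ne hc']
        simp only [of_apply, hc, if_false, stepMatrix, Subtype.coe_inj]
    rw [hm, det_stepMatrix_updateCol _ _ _ (node_notMem_minorIndices hkn hji)]
    simp [hji]

end Minors

/-! ### Coefficients of forest monomials -/

theorem edgeExponent_apply {n : ℕ} (G : OutGraph n) (v w : Fin (n + 1)) :
    edgeExponent G (v, w) = if G v = some w then 1 else 0 := by
  unfold edgeExponent
  rw [Finsupp.finsetSum_apply, Finset.sum_eq_single v]
  · cases h : G v <;> simp [Finsupp.single_apply]
  · intro u _ hu
    cases h : G u <;> simp [hu]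
  · simp

theorem edgeExponent_injective {n : ℕ} :
    Function.Injective (edgeExponent : OutGraph n → _) := by
  intro G G' h
  ext v w
  have := DFunLike.congr_fun h (v, w)
  simp only [edgeExponent_apply] at this
  by_cases h1 : G v = some w <;> by_cases h2 : G' v = some w <;> simp_all

open Classical in
theorem coeff_laplacianMinor {n k : ℕ} (hkn : k ≤ n) (i j : Fin k) {G : OutGraph n}
    (hG : G ∈ forests (special n k \ {node hkn i})) :
    MvPolynomial.coeff (edgeExponent G) (laplacianMinor hkn i j) =
      if MetaEdge G (node hkn i) (node hkn j) then (if j = i then 1 else -1) else 0 := by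
  rw [laplacianMinor_eq_sum, MvPolynomial.coeff_sum, Finset.sum_eq_single G]
  · split_ifs <;> simp [graphWeight_edgeVar]
  · intro G' _ hne
    have h : edgeExponent G' ≠ edgeExponent G := edgeExponent_injective.ne hne
    split_ifs <;> simp [graphWeight_edgeVar, MvPolynomial.coeff_monomial, h]
  · exact fun h => absurd hG h

theorem laplacianMinor_eq_sum_coeff {n k : ℕ} (hkn : k ≤ n) (i j : Fin k) :
    laplacianMinor hkn i j = ∑ G ∈ forests (special n k \ {node hkn i}),
      MvPolynomial.C (MvPolynomial.coeff (edgeExponent G) (laplacianMinor hkn i j)) *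
        graphWeight edgeVar G := by
  classical
  conv_lhs => rw [laplacianMinor_eq_sum]
  refine Finset.sum_congr rfl fun G hG => ?_
  rw [coeff_laplacianMinor hkn i j hG]
  split_ifs <;> simp

/-! ### Permutations along a reflexive relation with at most one proper successor -/

section Cycles

variable {α : Type*} {E : α → α → Prop}

theorem chain_iff_forall_next [DecidableEq α] {c : Cycle α} (hc : c.Nodup) :
    c.Chain E ↔ ∀ a (ha : a ∈ c), E a (c.next hc a ha) := by
  induction c using Quotient.inductionOn with
  | _ l =>
  cases l with
  | nil => exact ⟨fun _ a ha => (Cycle.notMem_nil a ha).elim, fun _ => Cycle.Chain.nil E⟩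
  | cons x l =>
    have hnd : (x :: l).Nodup := hc
    change Cycle.Chain E ((x :: l : List α) : Cycle α) ↔
      ∀ a (ha : a ∈ x :: l), E a ((x :: l).next a ha)
    -- A chain on a cycle is a chain on the list closed up by repeating `x`; this repetition absorbs
    -- the wrap-around of `next`.
    have hnext (i : ℕ) (hi : i < (x :: l).length) : (x :: l).next (x :: l)[i] (List.get_mem ..) =
        (x :: (l ++ [x]))[i + 1]'(by simpa using hi) := by
      rw [List.next_getElem _ hnd]
      rcases (Nat.lt_succ_iff_lt_or_eq.1 hi) with h | h
      · simp [Nat.mod_eq_of_lt, h]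
      · simp [h]
    have hget (i : ℕ) (hi : i < (x :: l).length) :
        (x :: (l ++ [x]))[i]'(by simp at hi ⊢; omega) = (x :: l)[i] := by
      simp only [← List.cons_append]
      rw [List.getElem_append_left hi]
    rw [Cycle.chain_coe_cons, List.isChain_iff_getElem]
    constructor
    · intro h a ha
      obtain ⟨i, hi, rfl⟩ := List.getElem_of_mem ha
      rw [hnext, ← hget i hi]
      exact h i _
    · intro h i hi
      have hi' : i < (x :: l).length := by simpa using hi
      have := h _ (List.getElem_mem hi')
      rwa [hnext, ← hget i hi'] at this

variable [Fintype α] [DecidableEq α]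

/-- The permutations moving each point along `E`. -/
def PermAlong (E : α → α → Prop) (σ : Equiv.Perm α) : Prop := ∀ i, E i (σ i)

open Equiv Equiv.Perm

theorem chain_toCycle_iff (hrefl : ∀ i, E i i) (f : Perm α) (hf : f.IsCycle) :
    (f.toCycle hf).Chain E ↔ PermAlong E f := by
  rw [chain_iff_forall_next (nodup_toCycle f hf)]
  simp only [toCycle_next, mem_toCycle_iff_support]
  refine forall_congr' fun a => ⟨fun h => ?_, fun h _ => h⟩
  by_cases ha : f a = a
  · rw [ha]
    exact hrefl a
  · exact h ha

theorem ncard_chain_cycles (hrefl : ∀ i, E i i) :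
    Set.ncard {c : Cycle α | c.Nodup ∧ c.Nontrivial ∧ c.Chain E} =
      Set.ncard {f : Perm α | f.IsCycle ∧ PermAlong E f} := by
  symm
  refine Set.ncard_congr (fun f hf => f.toCycle hf.1) ?_ ?_ ?_
  · rintro f ⟨hf, hE⟩
    exact ⟨nodup_toCycle f hf, nontrivial_toCycle f hf, (chain_toCycle_iff hrefl f hf).2 hE⟩
  · intro f g ⟨hf, _⟩ ⟨hg, _⟩ h
    have := isoCycle.injective (a₁ := ⟨f, hf⟩) (a₂ := ⟨g, hg⟩) (Subtype.ext h)
    exact congrArg Subtype.val this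
  · rintro c ⟨hc, hc', hE⟩
    obtain ⟨⟨f, hf⟩, h⟩ := isoCycle.surjective ⟨c, hc, hc'⟩
    have h' : f.toCycle hf = c := congrArg Subtype.val h
    exact ⟨f, ⟨hf, (chain_toCycle_iff hrefl f hf).1 (h' ▸ hE)⟩, h'⟩

open Classical in
/-- The cyclic permutations moving each point along `E`. -/
noncomputable def cyclesAlong (E : α → α → Prop) : Finset (Perm α) :=
  Finset.univ.filter fun f => f.IsCycle ∧ PermAlong E f

theorem mem_cyclesAlong {f : Perm α} : f ∈ cyclesAlong E ↔ f.IsCycle ∧ PermAlong E f := by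
  simp [cyclesAlong]

theorem card_cyclesAlong (hrefl : ∀ i, E i i) :
    (cyclesAlong E).card = Set.ncard {c : Cycle α | c.Nodup ∧ c.Nontrivial ∧ c.Chain E} := by
  rw [ncard_chain_cycles hrefl, ← Set.ncard_coe_finset]
  congr 1
  ext f
  simp [mem_cyclesAlong]

theorem permAlong_iff_cycleFactorsFinset_subset (hrefl : ∀ i, E i i) (σ : Perm α) :
    PermAlong E σ ↔ σ.cycleFactorsFinset ⊆ cyclesAlong E := by
  constructor
  · intro hσ f hf
    obtain ⟨hf, hf'⟩ := mem_cycleFactorsFinset_iff.1 hf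
    refine mem_cyclesAlong.2 ⟨hf, fun i => ?_⟩
    by_cases hi : i ∈ f.support
    · rw [hf' i hi]
      exact hσ i
    · rw [notMem_support.1 hi]
      exact hrefl i
  · intro h i
    by_cases hi : i ∈ σ.support
    · have := (mem_cyclesAlong.1 (h (cycleOf_mem_cycleFactorsFinset_iff.2 hi))).2 i
      rwa [cycleOf_apply_self] at this
    · rw [notMem_support.1 hi]
      exact hrefl i

/-- Two cycles along `E` agree wherever both move a point, so they coincide as soon as their
supports meet. -/
theorem pairwise_disjoint_cyclesAlong (hfun : ∀ a b c, E a b → E a c → b ≠ a → c ≠ a → b = c) :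
    (cyclesAlong E : Set (Perm α)).Pairwise Perm.Disjoint := by
  intro f hf g hg hne
  rw [Finset.mem_coe, mem_cyclesAlong] at hf hg
  rw [disjoint_iff_disjoint_support, Finset.disjoint_left]
  intro x hxf hxg
  have key : ∀ x ∈ f.support ∩ g.support, f x = g x := fun x hx =>
    hfun x _ _ (hf.2 x) (hg.2 x) (mem_support.1 (Finset.mem_inter.1 hx).1)
      (mem_support.1 (Finset.mem_inter.1 hx).2)
  exact hne (hf.1.eq_on_support_inter_nonempty_congr hg.1 key
    (key x (Finset.mem_inter.2 ⟨hxf, hxg⟩)) hxf)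

-- Disjointness lets any set of cycles along `E` be multiplied to a permutation with exactly these
-- cycle factors; reflexivity takes care of the fixed points.
open Classical in
theorem image_cycleFactorsFinset (hrefl : ∀ i, E i i)
    (hfun : ∀ a b c, E a b → E a c → b ≠ a → c ≠ a → b = c) :
    (Finset.univ.filter (PermAlong E)).image cycleFactorsFinset = (cyclesAlong E).powerset := by
  ext T
  simp only [Finset.mem_image, Finset.mem_filter, Finset.mem_univ, true_and, Finset.mem_powerset,
    permAlong_iff_cycleFactorsFinset_subset hrefl]
  constructor
  · rintro ⟨σ, h, rfl⟩
    exact h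
  · intro h
    have hT : (T : Set (Perm α)).Pairwise Perm.Disjoint :=
      (pairwise_disjoint_cyclesAlong hfun).mono (Finset.coe_subset.2 h)
    refine ⟨T.noncommProd id (hT.mono' fun _ _ => Perm.Disjoint.commute), ?_⟩
    rw [(cycleFactorsFinset_eq_finset (s := T)).2
      ⟨fun f hf => (mem_cyclesAlong.1 (h hf)).1, hT, rfl⟩]
    exact ⟨h, rfl⟩

open Classical in
theorem sum_permAlong (hrefl : ∀ i, E i i)
    (hfun : ∀ a b c, E a b → E a c → b ≠ a → c ≠ a → b = c) {M : Type*} [AddCommMonoid M]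
    (φ : Finset (Perm α) → M) :
    ∑ σ ∈ Finset.univ.filter (PermAlong E), φ σ.cycleFactorsFinset =
      ∑ T ∈ (cyclesAlong E).powerset, φ T := by
  rw [← image_cycleFactorsFinset hrefl hfun, Finset.sum_image cycleFactorsFinset_injective.injOn]

open Classical in
theorem card_permAlong (hrefl : ∀ i, E i i)
    (hfun : ∀ a b c, E a b → E a c → b ≠ a → c ≠ a → b = c) :
    (Finset.univ.filter (PermAlong E)).card = 2 ^ (cyclesAlong E).card := by
  rw [← Finset.card_powerset, Finset.card_eq_sum_ones, Finset.card_eq_sum_ones]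
  exact sum_permAlong hrefl hfun fun _ => 1

open Classical in
theorem sum_sign_permAlong (hrefl : ∀ i, E i i)
    (hfun : ∀ a b c, E a b → E a c → b ≠ a → c ≠ a → b = c) (hne : (cyclesAlong E).Nonempty) :
    ∑ σ ∈ Finset.univ.filter (PermAlong E), (-1 : ℤ) ^ σ.cycleFactorsFinset.card = 0 := by
  rw [sum_permAlong hrefl hfun fun T => (-1 : ℤ) ^ T.card,
    Finset.sum_powerset_neg_one_pow_card_of_nonempty hne]

/-- The sign is -1 to the power of support size plus number of cycles, and the product cancels the
support size. -/
theorem sign_mul_prod_ite (σ : Perm α) :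
    (sign σ : ℤ) * ∏ i, (if σ i = i then (1 : ℤ) else -1) = (-1) ^ σ.cycleFactorsFinset.card := by
  have h : ∏ i, (if σ i = i then (1 : ℤ) else -1) = (-1) ^ σ.support.card := by
    rw [Finset.prod_ite, Finset.prod_const_one, one_mul, Finset.prod_const]
    rfl
  rw [h, sign_of_cycleType, sum_cycleType, cycleType_def, Multiset.card_map]
  push_cast
  rw [pow_add, mul_right_comm, ← pow_add, Even.neg_one_pow ⟨_, rfl⟩, one_mul]
  rfl

end Cycles

theorem card_filter_eq_of_sum_eq_zero {ι : Type*} [DecidableEq ι] (s : Finset ι) (f : ι → ℤ)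
    (hf : ∀ i ∈ s, f i = 1 ∨ f i = -1) (h0 : ∑ i ∈ s, f i = 0) {m : ℕ} (hs : s.card = 2 * m) :
    (s.filter fun i => f i = 1).card = m ∧ (s.filter fun i => f i = -1).card = m := by
  have h1 : ∑ i ∈ s, f i = (s.filter fun i => f i = 1).card - (s.filter fun i => f i = -1).card := by
    rw [Finset.card_filter, Finset.card_filter]
    push_cast
    rw [← Finset.sum_sub_distrib]
    refine Finset.sum_congr rfl fun i hi => ?_
    rcases hf i hi with h | h <;> simp [h]
  have h2 : (s.card : ℤ) =
      (s.filter fun i => f i = 1).card + (s.filter fun i => f i = -1).card := by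
    rw [Finset.card_filter, Finset.card_filter, Finset.card_eq_sum_ones]
    push_cast
    rw [← Finset.sum_add_distrib]
    refine Finset.sum_congr rfl fun i hi => ?_
    rcases hf i hi with h | h <;> simp [h]
  omega

/-! ### Meta-cycles and contributions of forest tuples -/

theorem MetaEdge.unique {n : ℕ} {G : OutGraph n} {v w w' : Fin (n + 1)} (h : MetaEdge G v w)
    (h' : MetaEdge G v w') (hw : G w = none) (hw' : G w' = none) : w = w' := by
  unfold MetaEdge at h
  induction h using Relation.ReflTransGen.head_induction_on with
  | refl => exact h'.eq_of_none hw
  | head hab _ ih =>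
    rcases metaEdge_iff.1 h' with rfl | ⟨u, hu, huw⟩
    · rw [hab] at hw'
      simp at hw'
    · rw [hab] at hu
      exact ih (Option.some.inj hu ▸ huw)

section Tuples

variable {n k : ℕ} (hkn : k ≤ n)

/-- The relation `a → b` on `{1, …, k}`: the `a`-th forest has a meta-edge `a → b`. -/
def MetaStep (F : Fin k → OutGraph n) (a b : Fin k) : Prop :=
  MetaEdge (F a) (node hkn a) (node hkn b)

theorem metaStep_refl (F : Fin k → OutGraph n) (a : Fin k) : MetaStep hkn F a a :=
  Relation.ReflTransGen.refl

variable {F : Fin k → OutGraph n}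

theorem mem_forests_of_mem_forestTuples (hF : F ∈ forestTuples hkn) (i : Fin k) :
    F i ∈ forests (special n k \ {node hkn i}) :=
  Fintype.mem_piFinset.1 hF i

/-- The nodes of `b` and `c` are roots of `F a`, and a node reaches only one root. -/
theorem metaStep_unique (hF : F ∈ forestTuples hkn) (a b c : Fin k) (hb : MetaStep hkn F a b)
    (hc : MetaStep hkn F a c) (hba : b ≠ a) (hca : c ≠ a) : b = c := by
  have hG : IsForestRootedAt (special n k \ {node hkn a}) (F a) := by
    simpa [forests] using mem_forests_of_mem_forestTuples hkn hF a
  have hroot (d : Fin k) (hd : d ≠ a) : F a (node hkn d) = none := by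
    rw [hG.1, Finset.mem_sdiff, Finset.mem_singleton]
    refine ⟨?_, (node_injective hkn).ne hd⟩
    have hdk : (node hkn d).val ≤ k := d.isLt
    simpa [special] using hdk
  exact node_injective hkn (hb.unique hc (hroot b hba) (hroot c hca))

theorem memR_iff (hF : F ∈ forestTuples hkn) (σ : Equiv.Perm (Fin k)) :
    MemR hkn σ F ↔ PermAlong (MetaStep hkn F) σ :=
  and_iff_right hF

open Classical in
theorem contribution_eq_ite (hF : F ∈ forestTuples hkn) (σ : Equiv.Perm (Fin k)) :
    contribution hkn σ F = if PermAlong (MetaStep hkn F) σ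
      then (-1) ^ σ.cycleFactorsFinset.card else 0 := by
  rw [contribution]
  split_ifs with h
  · rw [← sign_mul_prod_ite]
    congr 1
    refine Finset.prod_congr rfl fun i _ => ?_
    rw [coeff_laplacianMinor hkn i (σ i) (mem_forests_of_mem_forestTuples hkn hF i)]
    exact if_pos (h i)
  · obtain ⟨i, hi⟩ := not_forall.1 h
    rw [Finset.prod_eq_zero (Finset.mem_univ i), mul_zero]
    rw [coeff_laplacianMinor hkn i (σ i) (mem_forests_of_mem_forestTuples hkn hF i), if_neg]
    exact hi

theorem contribution_ne_zero_iff (hF : F ∈ forestTuples hkn) (σ : Equiv.Perm (Fin k)) :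
    contribution hkn σ F ≠ 0 ↔ PermAlong (MetaStep hkn F) σ := by
  classical
  rw [contribution_eq_ite hkn hF]
  split_ifs with h <;> simp [h]

theorem card_cyclesAlong_metaStep (F : Fin k → OutGraph n) :
    (cyclesAlong (MetaStep hkn F)).card = numMetaCycles hkn F :=
  card_cyclesAlong (metaStep_refl hkn F)

theorem exists_isMetaCycle_iff (F : Fin k → OutGraph n) :
    (∃ c, IsMetaCycle hkn F c) ↔ (cyclesAlong (MetaStep hkn F)).Nonempty := by
  constructor
  · rintro ⟨c, hc, hc', hE⟩
    obtain ⟨⟨f, hf⟩, h⟩ := Equiv.Perm.isoCycle.surjective ⟨c, hc, hc'⟩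
    have h' : f.toCycle hf = c := congrArg Subtype.val h
    exact ⟨f, mem_cyclesAlong.2 ⟨hf, (chain_toCycle_iff (metaStep_refl hkn F) f hf).1 (h' ▸ hE)⟩⟩
  · rintro ⟨f, hf⟩
    obtain ⟨hf, hE⟩ := mem_cyclesAlong.1 hf
    exact ⟨f.toCycle hf, f.nodup_toCycle hf, f.nontrivial_toCycle hf,
      (chain_toCycle_iff (metaStep_refl hkn F) f hf).2 hE⟩

theorem sum_contribution_of_isMetaCycle (hF : F ∈ forestTuples hkn)
    (hc : ∃ c, IsMetaCycle hkn F c) : ∑ σ : Equiv.Perm (Fin k), contribution hkn σ F = 0 := by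
  classical
  simp only [contribution_eq_ite hkn hF]
  rw [← Finset.sum_filter]
  exact sum_sign_permAlong (metaStep_refl hkn F) (metaStep_unique hkn hF)
    ((exists_isMetaCycle_iff hkn F).1 hc)

theorem contribution_counts_of_isMetaCycle (hF : F ∈ forestTuples hkn)
    (hc : ∃ c, IsMetaCycle hkn F c) :
    1 ≤ numMetaCycles hkn F ∧
      Set.ncard {σ : Equiv.Perm (Fin k) | contribution hkn σ F ≠ 0} =
        2 ^ numMetaCycles hkn F ∧
      Set.ncard {σ : Equiv.Perm (Fin k) | contribution hkn σ F = 1} =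
        2 ^ (numMetaCycles hkn F - 1) ∧
      Set.ncard {σ : Equiv.Perm (Fin k) | contribution hkn σ F = -1} =
        2 ^ (numMetaCycles hkn F - 1) ∧
      ∑ σ : Equiv.Perm (Fin k), contribution hkn σ F = 0 := by
  classical
  have hpos : 1 ≤ numMetaCycles hkn F := by
    rw [← card_cyclesAlong_metaStep]
    exact Finset.card_pos.2 ((exists_isMetaCycle_iff hkn F).1 hc)
  have hsum := sum_contribution_of_isMetaCycle hkn hF hc
  have hcard := card_permAlong (metaStep_refl hkn F) (metaStep_unique hkn hF)
  rw [card_cyclesAlong_metaStep] at hcard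
  simp only [← contribution_ne_zero_iff hkn hF] at hcard
  -- Contributions ±1 with sum zero split evenly; at least one meta-cycle makes the exponent `m - 1`
  -- a true subtraction.
  have hhalf := card_filter_eq_of_sum_eq_zero
    (Finset.univ.filter fun σ => contribution hkn σ F ≠ 0) (fun σ => contribution hkn σ F)
    (fun σ hσ => by
      have hσ' := (contribution_ne_zero_iff hkn hF σ).1 (Finset.mem_filter.1 hσ).2
      rw [contribution_eq_ite hkn hF, if_pos hσ']
      exact neg_one_pow_eq_or ℤ _)
    ((Finset.sum_filter_ne_zero _).trans hsum) (m := 2 ^ (numMetaCycles hkn F - 1))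
    (by rw [hcard, ← pow_succ', Nat.sub_add_cancel hpos])
  have hset (x : ℤ) (hx : x ≠ 0) : Set.ncard {σ : Equiv.Perm (Fin k) | contribution hkn σ F = x} =
      ((Finset.univ.filter fun σ => contribution hkn σ F ≠ 0).filter
        fun σ => contribution hkn σ F = x).card := by
    rw [← Set.ncard_coe_finset]
    congr 1
    ext σ
    simp only [Set.mem_ofPred_eq, Finset.coe_filter, Finset.mem_filter, Finset.mem_univ, true_and]
    exact ⟨fun h => ⟨h ▸ hx, h⟩, fun h => h.2⟩
  refine ⟨hpos, ?_, ?_, ?_, hsum⟩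
  · rw [← hcard, ← Set.ncard_coe_finset]
    congr 1
    ext σ
    simp
  · rw [hset 1 one_ne_zero]
    exact hhalf.1
  · rw [hset (-1) (by simp)]
    exact hhalf.2

theorem contribution_of_not_isMetaCycle (hF : F ∈ forestTuples hkn)
    (hc : ¬ ∃ c, IsMetaCycle hkn F c) (σ : Equiv.Perm (Fin k)) :
    contribution hkn σ F = if σ = 1 then 1 else 0 := by
  classical
  rw [exists_isMetaCycle_iff, Finset.not_nonempty_iff_eq_empty] at hc
  have h : PermAlong (MetaStep hkn F) σ ↔ σ = 1 := by
    rw [permAlong_iff_cycleFactorsFinset_subset (metaStep_refl hkn F), hc, Finset.subset_empty,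
      Equiv.Perm.cycleFactorsFinset_eq_empty_iff]
  rw [contribution_eq_ite hkn hF]
  simp only [h]
  split_ifs with hσ
  · simp [hσ]
  · rfl

theorem muirTerm_eq_sum (σ : Equiv.Perm (Fin k)) : muirTerm hkn σ =
    ∑ F ∈ forestTuples hkn, MvPolynomial.C (contribution hkn σ F) * tupleWeight F := by
  have h : ∏ i, laplacianMinor hkn i (σ i) = ∏ i, ∑ G ∈ forests (special n k \ {node hkn i}),
      MvPolynomial.C (MvPolynomial.coeff (edgeExponent G) (laplacianMinor hkn i (σ i))) *
        graphWeight edgeVar G :=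
    Finset.prod_congr rfl fun i _ => laplacianMinor_eq_sum_coeff hkn i (σ i)
  -- Distributing the product chooses one forest per factor, which is a member of `forestTuples`.
  rw [muirTerm, h, Finset.prod_univ_sum, Finset.mul_sum]
  refine Finset.sum_congr rfl fun F _ => ?_
  rw [contribution, tupleWeight, Finset.prod_mul_distrib, map_mul, map_prod, mul_assoc]
  simp

theorem sum_muirTerm : ∑ σ : Equiv.Perm (Fin k), muirTerm hkn σ =
    ∑ F ∈ nonForbiddenTuples hkn, tupleWeight F := by
  classical
  simp only [muirTerm_eq_sum]
  rw [Finset.sum_comm, nonForbiddenTuples, Finset.sum_filter]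
  refine Finset.sum_congr rfl fun F hF => ?_
  rw [← Finset.sum_mul, ← map_sum]
  by_cases hc : ∃ c, IsMetaCycle hkn F c
  · simp [sum_contribution_of_isMetaCycle hkn hF hc, hc]
  · simp only [contribution_of_not_isMetaCycle hkn hF hc]
    simp [hc]

end Tuples

end ForestDodgson

theorem mainTheorem3 (n k : ℕ) (hk : 1 ≤ k) (hkn : k ≤ n) :
    -- each determinant, hence each term of the sum, expands over (tuples of) forests
    (∀ i j : Fin k, laplacianMinor hkn i j =
      ∑ G ∈ forests (special n k \ {node hkn i}),
        MvPolynomial.C (MvPolynomial.coeff (edgeExponent G) (laplacianMinor hkn i j)) *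
          graphWeight edgeVar G) ∧
    (∀ σ : Equiv.Perm (Fin k), muirTerm hkn σ =
      ∑ F ∈ forestTuples hkn, MvPolynomial.C (contribution hkn σ F) * tupleWeight F) ∧
    -- a tuple arises from `σ` iff it lies in `R^σ`, with the sign given by the cycles of `σ`
    (∀ F ∈ forestTuples hkn, ∀ σ : Equiv.Perm (Fin k),
      (contribution hkn σ F ≠ 0 ↔ MemR hkn σ F) ∧
      (MemR hkn σ F → contribution hkn σ F = (-1) ^ σ.cycleFactorsFinset.card)) ∧
    -- a tuple with `m ≥ 1` meta-cycles arises from `2 ^ m` permutations, and cancels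
    (∀ F ∈ forestTuples hkn, (∃ c, IsMetaCycle hkn F c) →
      1 ≤ numMetaCycles hkn F ∧
      Set.ncard {σ : Equiv.Perm (Fin k) | contribution hkn σ F ≠ 0} =
        2 ^ numMetaCycles hkn F ∧
      Set.ncard {σ : Equiv.Perm (Fin k) | contribution hkn σ F = 1} =
        2 ^ (numMetaCycles hkn F - 1) ∧
      Set.ncard {σ : Equiv.Perm (Fin k) | contribution hkn σ F = -1} =
        2 ^ (numMetaCycles hkn F - 1) ∧
      ∑ σ : Equiv.Perm (Fin k), contribution hkn σ F = 0) ∧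
    -- a tuple without meta-cycle arises exactly once, from the identity, with sign `+`
    (∀ F ∈ forestTuples hkn, (¬ ∃ c, IsMetaCycle hkn F c) →
      ∀ σ : Equiv.Perm (Fin k), contribution hkn σ F = if σ = 1 then 1 else 0) ∧
    -- so the whole sum is the generating function of the tuples without meta-cycle
    ∑ σ : Equiv.Perm (Fin k), muirTerm hkn σ = ∑ F ∈ nonForbiddenTuples hkn, tupleWeight F := by
  exact ⟨laplacianMinor_eq_sum_coeff hkn, muirTerm_eq_sum hkn,
    fun F hF σ => ⟨by rw [contribution_ne_zero_iff hkn hF, memR_iff hkn hF], fun h => by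
      classical
      rw [contribution_eq_ite hkn hF, if_pos ((memR_iff hkn hF σ).1 h)]⟩,
    fun _ hF hc => contribution_counts_of_isMetaCycle hkn hF hc,
    fun _ hF hc σ => contribution_of_not_isMetaCycle hkn hF hc σ,
    sum_muirTerm hkn⟩
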